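/- Let $0<r<n$, let $\alpha,\beta,\zeta\in\mathbb C$, let $C$ be a complex $r\times(n-r)$ matrix, and let $$A=\begin{bmatrix}\alpha I_r & C\\ D & \beta I_{n-r}\end{bmatrix},\qquad D=\zeta\,C^*.$$ For $1\le k\le n$ let $\Lambda_k(A)$ be the set of all $\lambda\in\mathbb C$ such that $PAP=\lambda P$ for some orthogonal projection $P$ of rank $k$. Let $p=\operatorname{rank}C$, let $s_1\ge\dots\ge s_p$ be the nonzero singular values of $C$ (with multiplicity), and let $m=\min\{n-r,r\}$, $M=\max\{n-r,r\}$. For $1\le k\le p$ put $\Delta_k=(\alpha-\beta)^2+4\zeta s_k^2$ and let $\mathcal E_k$ be the closed elliptical disc (possibly degenerate to a line segment) with foci $\tfrac12(\alpha+\beta)\pm\tfrac12\sqrt{\Delta_k}$ and with major and minor axes of lengths $$\sqrt{\tfrac12|\alpha-\beta|^2+(1+|\zeta|^2)s_k^2+\tfrac12|\Delta_k|}\quad\text{and}\quad\sqrt{\tfrac12|\alpha-\beta|^2+(1+|\zeta|^2)s_k^2-\tfrac12|\Delta_k|}.$$ Let $[\alpha,\beta]$ be the line segment joining $\alpha$ and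 $\beta$ (equal to $\{\alpha\}$ if $\alpha=\beta$). Then: - $\Lambda_k(A)=\mathcal E_k$ for $1\le k\le p$; - $\Lambda_k(A)=[\alpha,\beta]$ for $p<k\le m$; - for $m<k\le M$: $\Lambda_k(A)=\{\alpha\}$ if $n<2r$, and $\Lambda_k(A)=\{\beta\}$ if $n>2r$ (there is no such $k$ if $n=2r$); - if $\alpha\ne\beta$, then $\Lambda_k(A)=\emptyset$ for $M<k\le n$; - if $\alpha=\beta$, then $\Lambda_k(A)=\{\alpha\}$ for $M<k\le n-p$, and $\Lambda_k(A)=\emptyset$ for $n-p<k\le n$. (In particular, if $p=m$, then $n-p=M$ and $\Lambda_k(A)=\emptyset$ for all $M<k\le n$ in this case too.) -/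

import Mathlib

open Matrix

/-- The rank-`k` numerical range `Λ_k(A)` of a complex square matrix: all `z` such that
`P A P = z P` for some orthogonal projection `P` of rank `k`. -/
def higherRankNumericalRange {ι : Type*} [Fintype ι] [DecidableEq ι]
    (k : ℕ) (A : Matrix ι ι ℂ) : Set ℂ :=
  {z | ∃ P : Matrix ι ι ℂ, IsStarProjection P ∧ P.rank = k ∧ P * A * P = z • P}

/-- The `k`-th largest singular value (`k = 1, 2, …`, counted with multiplicity) of a complex
matrix, regarded as a linear map between Euclidean spaces. Mathlib numbers them from `0`. -/
noncomputable def matrixSingularValue {m n : ℕ} (C : Matrix (Fin m) (Fin n) ℂ) (k : ℕ) : ℝ :=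
  (Matrix.toEuclideanLin C).singularValues (k - 1)

/-- `S` is the closed elliptical disc with foci `f₁`, `f₂`, whose major and minor axes have
(full) lengths `a` and `b`. When `b = 0` it degenerates into the line segment joining the foci,
and when `f₁ = f₂` it is the circular disc of diameter `a = b`. -/
structure IsEllipticalDisc (S : Set ℂ) (f₁ f₂ : ℂ) (a b : ℝ) : Prop where
  major_nonneg : 0 ≤ a
  minor_nonneg : 0 ≤ b
  sq_major : a ^ 2 = b ^ 2 + dist f₁ f₂ ^ 2
  eq_setOf : S = {z : ℂ | dist z f₁ + dist z f₂ ≤ a}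

/-! A singular value decomposition of `C` is a unitary similarity that splits `A` into 2×2 blocks
`[[α, s_j], [ζ s_j, β]]` together with unpaired diagonal entries `α` or `β`. After translation by
`(α + β) / 2`, the numerical range of a block is an ellipse. It grows with `s_j`, so the first `k`
numerical ranges all contain the `k`-th, and one unit vector from each block spans a `k`-dimensional
space on which the compression is scalar
(`mem_higherRankNumericalRange_of_sub_mem_blockSupportSet`).

Every upper bound is a dimension count: the range of a rank-`k` projection meets the kernel of any
system of fewer than `k` linear equations (`exists_ne_zero_of_mem_higherRankNumericalRange`). For `k
≤ m` the equations are chosen, for each direction `u`, to make the first `k - 1` blocks harmless,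
which leaves the supporting half-planes of the `k`-th ellipse. For larger `k` they kill all
coordinates of one kind, forcing `z = α` or `z = β`; when `α = β`, a finer system of `n - p`
equations isolates the off-diagonal part of the form and yields emptiness. -/

/-! ### Ellipses as intersections of half-planes. -/

theorem two_mul_re_mul_sq (u z : ℂ) (hu : ‖u‖ = 1) :
    2 * (u * z).re ^ 2 = ‖z‖ ^ 2 + (u ^ 2 * z ^ 2).re := by
  have h : u.re ^ 2 + u.im ^ 2 = 1 := by
    have := Complex.sq_norm u
    rw [hu, Complex.normSq_apply] at this; linarith
  rw [Complex.sq_norm, Complex.normSq_apply]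
  simp only [pow_two, Complex.mul_re, Complex.mul_im]
  linear_combination (z.re ^ 2 + z.im ^ 2) * h

open ComplexConjugate in
theorem norm_add_conj_mul_sq (u ζ : ℂ) (hu : ‖u‖ = 1) :
    ‖u + conj (u * ζ)‖ ^ 2 = 1 + ‖ζ‖ ^ 2 + 2 * (u ^ 2 * ζ).re := by
  have h : u.re ^ 2 + u.im ^ 2 = 1 := by
    have := Complex.sq_norm u
    rw [hu, Complex.normSq_apply] at this; linarith
  rw [Complex.sq_norm, Complex.normSq_apply, Complex.sq_norm, Complex.normSq_apply]
  simp only [pow_two, Complex.mul_re, Complex.mul_im, Complex.add_re, Complex.add_im,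
    Complex.conj_re, Complex.conj_im]
  linear_combination (1 + ζ.re ^ 2 + ζ.im ^ 2) * h

theorem exists_unit_sq_mul_eq_norm (w : ℂ) : ∃ u : ℂ, ‖u‖ = 1 ∧ u ^ 2 * w = ‖w‖ := by
  refine ⟨Complex.exp (((-w.arg / 2 : ℝ) : ℂ) * Complex.I), Complex.norm_exp_ofReal_mul_I _, ?_⟩
  conv_lhs => enter [2]; rw [← Complex.norm_mul_exp_arg_mul_I w]
  rw [← Complex.exp_nat_mul, mul_left_comm, ← Complex.exp_add]
  rw [show ((2 : ℕ) : ℂ) * (((-w.arg / 2 : ℝ) : ℂ) * Complex.I) + w.arg * Complex.I = 0 by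
    push_cast; ring]
  simp

theorem exists_unit_mul_eq_norm (w : ℂ) : ∃ u : ℂ, ‖u‖ = 1 ∧ u * w = ‖w‖ := by
  obtain ⟨u, hu, h⟩ := exists_unit_sq_mul_eq_norm w
  exact ⟨u ^ 2, by simp [hu], h⟩

open ComplexConjugate in
/-- The intersection of the supporting half-planes of the numerical range of
`[[γ, s], [ζ s, -γ]]`. -/
def blockSupportSet (γ ζ : ℂ) (s : ℝ) : Set ℂ :=
  {z | ∀ u : ℂ, ‖u‖ = 1 →
    (u * z).re ^ 2 ≤ (u * γ).re ^ 2 + s ^ 2 * ‖u + conj (u * ζ)‖ ^ 2 / 4}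

theorem mem_blockSupportSet_iff {γ ζ : ℂ} {s : ℝ} {z : ℂ} :
    z ∈ blockSupportSet γ ζ s ↔
      ‖z‖ ^ 2 + ‖z ^ 2 - (γ ^ 2 + ζ * s ^ 2)‖ ≤ ‖γ‖ ^ 2 + s ^ 2 * (1 + ‖ζ‖ ^ 2) / 2 := by
  have key : ∀ u : ℂ, ‖u‖ = 1 →
      ((u * z).re ^ 2 ≤ (u * γ).re ^ 2 +
          s ^ 2 * ‖u + (starRingEnd ℂ) (u * ζ)‖ ^ 2 / 4 ↔
        ‖z‖ ^ 2 + (u ^ 2 * (z ^ 2 - (γ ^ 2 + ζ * s ^ 2))).re ≤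
          ‖γ‖ ^ 2 + s ^ 2 * (1 + ‖ζ‖ ^ 2) / 2) := by
    intro u hu
    have h1 := two_mul_re_mul_sq u z hu
    have h2 := two_mul_re_mul_sq u γ hu
    rw [norm_add_conj_mul_sq u ζ hu]
    have h3 : (u ^ 2 * (z ^ 2 - (γ ^ 2 + ζ * s ^ 2))).re =
        (u ^ 2 * z ^ 2).re - (u ^ 2 * γ ^ 2).re - s ^ 2 * (u ^ 2 * ζ).re := by
      have : u ^ 2 * (z ^ 2 - (γ ^ 2 + ζ * s ^ 2)) =
        u ^ 2 * z ^ 2 - u ^ 2 * γ ^ 2 - ((s ^ 2 : ℝ) : ℂ) * (u ^ 2 * ζ) := by push_cast; ring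
      rw [this, Complex.sub_re, Complex.sub_re, Complex.re_ofReal_mul]
    rw [h3]
    constructor <;> intro h <;> linarith
  constructor
  · intro h
    -- The direction in which the half-plane condition is tightest: `u ^ 2` rotates this number onto
    -- the positive real axis.
    obtain ⟨u, hu, hw⟩ := exists_unit_sq_mul_eq_norm (z ^ 2 - (γ ^ 2 + ζ * s ^ 2))
    have := (key u hu).1 (h u hu)
    rwa [hw, Complex.ofReal_re] at this
  · intro h u hu
    refine (key u hu).2 (le_trans ?_ h)
    gcongr
    refine (Complex.re_le_norm _).trans ?_
    simp [hu]

theorem blockSupportSet_mono {γ ζ : ℂ} {s t : ℝ} (hs : 0 ≤ s) (hst : s ≤ t) :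
    blockSupportSet γ ζ s ⊆ blockSupportSet γ ζ t := by
  intro z hz u hu
  refine (hz u hu).trans ?_
  gcongr

/-- The parallelogram law handles the squares, and the cross term is the norm of `(z - f) * (z +
f)`. Hence only `f ^ 2` matters and the choice of square root for the foci is irrelevant. -/
theorem norm_sub_add_norm_add_sq (z f : ℂ) :
    (‖z - f‖ + ‖z + f‖) ^ 2 = 2 * ‖z‖ ^ 2 + 2 * ‖f‖ ^ 2 + 2 * ‖z ^ 2 - f ^ 2‖ := by
  have h : z ^ 2 - f ^ 2 = (z - f) * (z + f) := by ring
  rw [h, norm_mul]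
  have := parallelogram_law_with_norm ℝ z f
  nlinarith [this]

theorem norm_sub_add_norm_add_le_sqrt_iff {z f : ℂ} {N : ℝ} (hN : 0 ≤ N) :
    ‖z - f‖ + ‖z + f‖ ≤ √(2 * N + 2 * ‖f‖ ^ 2) ↔ ‖z‖ ^ 2 + ‖z ^ 2 - f ^ 2‖ ≤ N := by
  rw [Real.le_sqrt (by positivity) (by positivity), norm_sub_add_norm_add_sq]
  constructor <;> intro h <;> linarith

/-- With `s = 0` the foci are `±γ` and the allowed sum of focal distances is exactly their distance,
so membership is the equality case of the triangle inequality. -/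
theorem blockSupportSet_zero (γ ζ : ℂ) : blockSupportSet γ ζ 0 = segment ℝ γ (-γ) := by
  ext z
  rw [mem_segment_iff_wbtw, ← dist_add_dist_eq_iff, mem_blockSupportSet_iff]
  have h1 : dist γ z + dist z (-γ) = ‖z - γ‖ + ‖z + γ‖ := by
    rw [dist_comm, dist_eq_norm, dist_eq_norm, sub_neg_eq_add]
  have h2 : dist γ (-γ) = 2 * ‖γ‖ := by
    rw [dist_eq_norm, sub_neg_eq_add, ← two_mul, norm_mul]; simp
  have h3 : 2 * ‖γ‖ ≤ ‖z - γ‖ + ‖z + γ‖ := by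
    rw [← h2, ← h1]; exact dist_triangle _ _ _
  have h4 := norm_sub_add_norm_add_sq z γ
  rw [h1, h2]
  have e : z ^ 2 - (γ ^ 2 + ζ * ((0 : ℝ) : ℂ) ^ 2) = z ^ 2 - γ ^ 2 := by simp
  rw [e]
  have := norm_nonneg γ
  constructor
  · intro h
    refine le_antisymm ?_ h3
    apply le_of_sq_le_sq _ (by positivity)
    nlinarith
  · intro h
    rw [h] at h4
    nlinarith

/-! ### The numerical range of a 2×2 block fills its ellipse. -/

open ComplexConjugate in
/-- The Bloch-sphere parametrization of the numerical range of `[[γ, s], [ζ s, -γ]]`. -/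
noncomputable def blochMap (γ ζ : ℂ) (s : ℝ) : ℝ × ℂ →ₗ[ℝ] ℂ where
  toFun p := γ * p.1 + s / 2 * (p.2 + ζ * conj p.2)
  map_add' p q := by simp; ring
  map_smul' a p := by simp; ring

/-- The image of the unit ball is compact and convex, and its support function in direction `u` is
the square root of the bound in `blockSupportSet`; Hahn–Banach separation does the rest. -/
theorem exists_unit_ball_blochMap_eq {γ ζ : ℂ} {s : ℝ} {z : ℂ}
    (hz : z ∈ blockSupportSet γ ζ s) :
    ∃ p : ℝ × ℂ, p.1 ^ 2 + ‖p.2‖ ^ 2 ≤ 1 ∧ blochMap γ ζ s p = z := by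
  set K : Set (ℝ × ℂ) := {p | p.1 ^ 2 + ‖p.2‖ ^ 2 ≤ 1} with hK
  have hconv : Convex ℝ K := by
    have : ConvexOn ℝ Set.univ (fun p : ℝ × ℂ => p.1 ^ 2 + ‖p.2‖ ^ 2) := by
      refine ConvexOn.add ?_ ?_
      · exact (even_two.convexOn_pow (𝕜 := ℝ)).comp_linearMap (LinearMap.fst ℝ ℝ ℂ)
      · exact ((convexOn_univ_norm (E := ℂ)).pow (fun _ _ => norm_nonneg _) 2).comp_linearMap
          (LinearMap.snd ℝ ℝ ℂ)
    simpa [hK] using this.convex_le 1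
  have hcomp : IsCompact K := by
    refine Metric.isCompact_of_isClosed_isBounded ?_ ?_
    · exact isClosed_le (by fun_prop) continuous_const
    · refine (Metric.isBounded_closedBall (x := (0 : ℝ × ℂ)) (r := 1)).subset ?_
      intro p hp
      have hp : p.1 ^ 2 + ‖p.2‖ ^ 2 ≤ 1 := hp
      rw [mem_closedBall_zero_iff, Prod.norm_def, max_le_iff, Real.norm_eq_abs]
      constructor
      · rw [abs_le_one_iff_mul_self_le_one]; nlinarith [sq_nonneg ‖p.2‖]
      · nlinarith [sq_nonneg p.1, norm_nonneg p.2]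
  have hLcont : Continuous (blochMap γ ζ s) := LinearMap.continuous_of_finiteDimensional _
  by_contra hne
  have hz' : z ∉ blochMap γ ζ s '' K := by
    rintro ⟨p, hp, e⟩
    exact hne ⟨p, hp, e⟩
  obtain ⟨f, c, hf1, hf2⟩ := geometric_hahn_banach_closed_point
    (hconv.linear_image (blochMap γ ζ s)) (hcomp.image hLcont).isClosed hz'
  obtain ⟨w, hw⟩ : ∃ w : ℂ, ∀ x, f x = (w * x).re := by
    refine ⟨⟨f 1, -f Complex.I⟩, fun x => ?_⟩
    have hx : x = x.re • (1 : ℂ) + x.im • Complex.I := by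
      apply Complex.ext <;> simp
    conv_lhs => rw [hx, map_add, map_smul, map_smul]
    simp; ring
  obtain ⟨v, hv, hvw⟩ := exists_unit_mul_eq_norm w
  have hw0 : ‖w‖ ≠ 0 := by
    intro h
    have h0 := hf1 (blochMap γ ζ s 0) ⟨0, by simp [hK], rfl⟩
    simp only [hw, norm_eq_zero.1 h, zero_mul, Complex.zero_re] at h0 hf2
    linarith
  have hwpos : 0 < ‖w‖ := lt_of_le_of_ne (norm_nonneg _) hw0.symm
  set u : ℂ := w / ‖w‖ with hu
  have hunorm : ‖u‖ = 1 := by simp [hu, hw0]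
  have hwu : w = ‖w‖ * u := by
    rw [hu]; field_simp [Complex.ofReal_ne_zero.2 hw0]
  have hfu : ∀ x, f x = ‖w‖ * (u * x).re := by
    intro x
    rw [hw]
    conv_lhs => rw [hwu]
    rw [mul_assoc, Complex.re_ofReal_mul]
  set d : ℝ := (u * γ).re
  set κ : ℂ := u + (starRingEnd ℂ) (u * ζ) with hκ
  have hform : ∀ p : ℝ × ℂ, (u * blochMap γ ζ s p).re = d * p.1 + s / 2 * (κ * p.2).re := by
    intro p
    simp only [blochMap, LinearMap.coe_mk, AddHom.coe_mk, hκ, d]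
    have : u * (γ * p.1 + s / 2 * (p.2 + ζ * (starRingEnd ℂ) p.2)) =
      (p.1 : ℂ) * (u * γ) + ((s / 2 : ℝ) : ℂ) * (u * p.2 + u * ζ * (starRingEnd ℂ) p.2) := by
        push_cast; ring
    rw [this, Complex.add_re, Complex.re_ofReal_mul, Complex.re_ofReal_mul]
    simp
    ring
  have hbd := hz u hunorm
  set h : ℝ := √(d ^ 2 + s ^ 2 * ‖κ‖ ^ 2 / 4) with hh
  have hhsq : h ^ 2 = d ^ 2 + s ^ 2 * ‖κ‖ ^ 2 / 4 := Real.sq_sqrt (by positivity)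
  have hle : (u * z).re ≤ h := Real.le_sqrt_of_sq_le hbd
  have hc : c < ‖w‖ * (u * z).re := by rw [← hfu]; exact hf2
  rcases eq_or_ne h 0 with h0 | h0
  · have h1 := hf1 (blochMap γ ζ s 0) ⟨0, by simp [hK], rfl⟩
    rw [map_zero, map_zero] at h1
    nlinarith
  -- The maximiser over the ball of the functional in `hform`: its gradient `(d, s / 2 * conj κ)`,
  -- of length `h`, normalised. The maximum is `h`.
  · have hmem : ((d / h, ((s / (2 * h) : ℝ) : ℂ) * (starRingEnd ℂ) κ) : ℝ × ℂ) ∈ K := by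
      simp only [hK, Set.mem_ofPred_eq, norm_mul, Complex.norm_real, RCLike.norm_conj, mul_pow,
        Real.norm_eq_abs, sq_abs]
      have : (d / h) ^ 2 + (s / (2 * h)) ^ 2 * ‖κ‖ ^ 2 =
        (d ^ 2 + s ^ 2 * ‖κ‖ ^ 2 / 4) / h ^ 2 := by field_simp; ring
      rw [this, ← hhsq, div_self (pow_ne_zero 2 h0)]
    have h1 := hf1 _ ⟨_, hmem, rfl⟩
    rw [hfu, hform] at h1
    have h2 : (κ * (((s / (2 * h) : ℝ) : ℂ) * (starRingEnd ℂ) κ)).re = s / (2 * h) * ‖κ‖ ^ 2 := by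
      rw [mul_left_comm, Complex.re_ofReal_mul, Complex.mul_conj, Complex.ofReal_re,
        Complex.sq_norm]
    rw [h2] at h1
    have h3 : d * (d / h) + s / 2 * (s / (2 * h) * ‖κ‖ ^ 2) = h := by
      have : d * (d / h) + s / 2 * (s / (2 * h) * ‖κ‖ ^ 2) =
        (d ^ 2 + s ^ 2 * ‖κ‖ ^ 2 / 4) / h := by field_simp; ring
      rw [this, ← hhsq]; field_simp
    rw [h3] at h1
    nlinarith

/-- A linear map from real dimension 3 to 2 has a kernel; moving along it from a point of the ball
reaches the sphere without changing the image. -/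
theorem exists_unit_sphere_blochMap_eq {γ ζ : ℂ} {s : ℝ} {z : ℂ}
    (hz : z ∈ blockSupportSet γ ζ s) :
    ∃ p : ℝ × ℂ, p.1 ^ 2 + ‖p.2‖ ^ 2 = 1 ∧ blochMap γ ζ s p = z := by
  obtain ⟨p, hp, hpz⟩ := exists_unit_ball_blochMap_eq hz
  have hker : LinearMap.ker (blochMap γ ζ s) ≠ ⊥ := by
    apply LinearMap.ker_ne_bot_of_finrank_lt
    simp [Complex.finrank_real_complex]
  obtain ⟨g, hg, hg0⟩ := Submodule.exists_mem_ne_zero_of_ne_bot hker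
  set a : ℝ := g.1 ^ 2 + ‖g.2‖ ^ 2 with ha
  set b : ℝ := p.1 * g.1 + (p.2 * (starRingEnd ℂ) g.2).re with hb
  have hapos : 0 < a := by
    rcases eq_or_ne g.1 0 with h1 | h1
    · have h2 : g.2 ≠ 0 := fun h2 => hg0 (Prod.ext h1 h2)
      have := norm_pos_iff.2 h2
      positivity
    · positivity
  have hexp : ∀ t : ℝ, (p + t • g).1 ^ 2 + ‖(p + t • g).2‖ ^ 2 =
      (p.1 ^ 2 + ‖p.2‖ ^ 2) + 2 * t * b + t ^ 2 * a := by
    intro t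
    simp only [ha, hb, Complex.sq_norm, Complex.normSq_apply, Prod.fst_add, Prod.snd_add,
      Prod.smul_fst, Prod.smul_snd, smul_eq_mul, Complex.add_re, Complex.add_im,
      Complex.real_smul, Complex.mul_re, Complex.mul_im, Complex.conj_re, Complex.conj_im,
      Complex.ofReal_re, Complex.ofReal_im]
    ring
  set e : ℝ := p.1 ^ 2 + ‖p.2‖ ^ 2
  have hdisc : 0 ≤ b ^ 2 + a * (1 - e) := by
    have : 0 ≤ a * (1 - e) := mul_nonneg hapos.le (by linarith)
    positivity
  -- A root of `a * t ^ 2 + 2 * b * t = 1 - e`.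
  refine ⟨p + ((-b + √(b ^ 2 + a * (1 - e))) / a) • g, ?_, ?_⟩
  · rw [hexp]
    field_simp
    linear_combination Real.sq_sqrt hdisc
  · rw [map_add, map_smul, LinearMap.mem_ker.1 hg, smul_zero, add_zero, hpz]

-- The Hopf map `(a, b) ↦ (‖a‖ ^ 2 - ‖b‖ ^ 2, 2 * conj a * b)` sends unit vectors onto the sphere.
-- An explicit section takes `a` real, except at the pole `τ = -1`, where `a` would vanish.
open ComplexConjugate in
theorem exists_unit_vector_of_mem_blockSupportSet {γ ζ : ℂ} {s : ℝ} {z : ℂ}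
    (hz : z ∈ blockSupportSet γ ζ s) :
    ∃ a b : ℂ, ‖a‖ ^ 2 + ‖b‖ ^ 2 = 1 ∧
      γ * ((‖a‖ ^ 2 - ‖b‖ ^ 2 : ℝ) : ℂ) + s * (conj a * b + ζ * (conj b * a)) = z := by
  obtain ⟨⟨τ, v⟩, hp, hpz⟩ := exists_unit_sphere_blochMap_eq hz
  simp only [blochMap, LinearMap.coe_mk, AddHom.coe_mk] at hp hpz
  have hτ : -1 ≤ τ := by nlinarith [sq_nonneg ‖v‖]
  rcases eq_or_lt_of_le hτ with h | h
  · have hv : v = 0 := by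
      rw [← h] at hp
      have : ‖v‖ ^ 2 = 0 := by linarith
      simpa using this
    refine ⟨0, 1, by simp, ?_⟩
    rw [← hpz, hv, ← h]
    simp
  · set a : ℝ := √((1 + τ) / 2) with ha
    have hasq : a ^ 2 = (1 + τ) / 2 := Real.sq_sqrt (by linarith)
    have ha0 : a ≠ 0 := (Real.sqrt_pos.2 (by linarith)).ne'
    have haC : (a : ℂ) ≠ 0 := Complex.ofReal_ne_zero.2 ha0
    have hb : ‖v / (2 * a : ℂ)‖ ^ 2 = (1 - τ) / 2 := by
      rw [norm_div, norm_mul, Complex.norm_real, div_pow, mul_pow, Real.norm_eq_abs, sq_abs, hasq]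
      have : ‖v‖ ^ 2 = (1 - τ) * (1 + τ) := by linarith
      rw [this]
      have h1 : 1 + τ ≠ 0 := by linarith
      simp
      field_simp
    refine ⟨a, v / (2 * a), ?_, ?_⟩
    · rw [hb, Complex.norm_real, Real.norm_eq_abs, sq_abs, hasq]; ring
    · rw [hb, Complex.norm_real, Real.norm_eq_abs, sq_abs, hasq, ← hpz]
      simp only [map_div₀, map_mul, Complex.conj_ofReal, map_ofNat]
      push_cast
      field_simp
      ring

/-! ### Singular value decomposition. -/

/-- The `m × n` matrix with diagonal entries `s 0, s 1, …`. -/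
def rectDiagonal (m n : ℕ) (s : ℕ → ℝ) : Matrix (Fin m) (Fin n) ℂ :=
  Matrix.of fun i j => if i.val = j.val then (s i : ℂ) else 0

/-- The columns of `V` are eigenvectors of `T* T`; those of `U` are their normalised images under
`T` wherever `s i ≠ 0`, completed to an orthonormal basis. -/
theorem exists_singular_value_decomposition {m n : ℕ} (C : Matrix (Fin m) (Fin n) ℂ) :
    ∃ U : Matrix (Fin m) (Fin m) ℂ, ∃ V : Matrix (Fin n) (Fin n) ℂ,
      Uᴴ * U = 1 ∧ Vᴴ * V = 1 ∧
        Uᴴ * C * V = rectDiagonal m n (Matrix.toEuclideanLin C).singularValues := by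
  set T := Matrix.toEuclideanLin C with hT
  set s := T.singularValues with hs
  have hn : Module.finrank ℂ (EuclideanSpace ℂ (Fin n)) = n := by simp
  have hm : Module.finrank ℂ (EuclideanSpace ℂ (Fin m)) = m := by simp
  set v := T.isSymmetric_adjoint_comp_self.eigenvectorBasis hn with hv
  have hTT : ∀ j, T.adjoint (T (v j)) = ((s j ^ 2 : ℝ) : ℂ) • v j := by
    intro j
    rw [hs, T.sq_singularValues_fin hn j]
    exact T.isSymmetric_adjoint_comp_self.apply_eigenvectorBasis hn j
  have hinner : ∀ i j, inner ℂ (T (v i)) (T (v j)) = if i = j then ((s i ^ 2 : ℝ) : ℂ) else 0 := by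
    intro i j
    rw [← LinearMap.adjoint_inner_right, hTT, inner_smul_right, orthonormal_iff_ite.1 v.orthonormal]
    split_ifs with h
    · rw [h, mul_one]
    · rw [mul_zero]
  have hrank : ∀ j, s j ≠ 0 → j < m ∧ j < n := by
    intro j hj
    have hpos := (T.singularValues_pos_iff_ne_zero j).2 hj
    have h1 := T.singularValues_pos_iff_lt_finrank_range.1 hpos
    have h2 := Submodule.finrank_le (LinearMap.range T)
    have h3 := LinearMap.finrank_range_le T
    rw [hm] at h2
    rw [hn] at h3
    omega
  -- The value `0` is never used: the basis extension sees only indices with `s i ≠ 0`, and these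
  -- are below `n` by `hrank`.
  let w : Fin m → EuclideanSpace ℂ (Fin m) := fun i =>
    if h : i.val < n then ((s i : ℂ))⁻¹ • T (v ⟨i, h⟩) else 0
  have hw : Orthonormal ℂ (({i : Fin m | s i ≠ 0} : Set (Fin m)).domRestrict w) := by
    rw [orthonormal_iff_ite]
    rintro ⟨i, hi⟩ ⟨j, hj⟩
    have hi' : s i ≠ 0 := hi
    have hj' : s j ≠ 0 := hj
    simp only [Set.domRestrict_apply, w, dif_pos (hrank i hi').2, dif_pos (hrank j hj').2]
    rw [inner_smul_left, inner_smul_right, hinner]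
    simp only [Fin.mk.injEq, Subtype.mk.injEq, Fin.val_inj]
    split_ifs with h
    · subst h
      have : ((s i : ℝ) : ℂ) ≠ 0 := Complex.ofReal_ne_zero.2 hi'
      simp
      field_simp
    · simp
  obtain ⟨u, hu⟩ := hw.exists_orthonormalBasis_extension_of_card_eq (by simp)
  refine ⟨Matrix.of fun i j => u j i, Matrix.of fun i j => v j i, ?_, ?_, ?_⟩
  · ext i j
    have := orthonormal_iff_ite.1 u.orthonormal i j
    rw [PiLp.inner_apply] at this
    simp only [Matrix.mul_apply, Matrix.conjTranspose_apply, Matrix.of_apply, Matrix.one_apply]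
    rw [← this]
    exact Finset.sum_congr rfl fun k _ => by simp [mul_comm]
  · ext i j
    have := orthonormal_iff_ite.1 v.orthonormal i j
    rw [PiLp.inner_apply] at this
    simp only [Matrix.mul_apply, Matrix.conjTranspose_apply, Matrix.of_apply, Matrix.one_apply]
    rw [← this]
    exact Finset.sum_congr rfl fun k _ => by simp [mul_comm]
  · ext i j
    have h1 : ((Matrix.of fun i j => u j i : Matrix (Fin m) (Fin m) ℂ)ᴴ * C *
        (Matrix.of fun i j => v j i : Matrix (Fin n) (Fin n) ℂ)) i j =
          inner ℂ (u i) (T (v j)) := by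
      rw [PiLp.inner_apply, Matrix.mul_assoc, Matrix.mul_apply]
      refine Finset.sum_congr rfl fun k _ => ?_
      simp only [Matrix.conjTranspose_apply, Matrix.of_apply, RCLike.inner_apply, hT,
        Matrix.ofLp_toLpLin, Matrix.toLin'_apply, Matrix.mul_apply, Matrix.mulVec, dotProduct]
      simp [mul_comm]
    rw [h1]
    simp only [rectDiagonal, Matrix.of_apply]
    by_cases hj : s j = 0
    · have : T (v j) = 0 := by
        rw [← inner_self_eq_zero (𝕜 := ℂ), hinner]; simp [hj]
      rw [this, inner_zero_right]
      split_ifs with h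
      · rw [h, hj]; simp
      · rfl
    · have hjm := hrank j hj
      have e : T (v j) = (s j : ℂ) • u ⟨j, hjm.1⟩ := by
        rw [hu ⟨j, hjm.1⟩ hj]
        simp only [w, dif_pos hjm.2]
        rw [smul_smul, mul_inv_cancel₀ (Complex.ofReal_ne_zero.2 hj), one_smul]
      rw [e, inner_smul_right, orthonormal_iff_ite.1 u.orthonormal]
      simp only [Fin.ext_iff]
      split_ifs with h
      · rw [h, mul_one]
      · rw [mul_zero]

/-! ### Compressions, unitary invariance and the dimension count. -/

section

variable {ι κ : Type*} [Fintype ι] [DecidableEq ι] [Fintype κ]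

open ComplexOrder in
theorem mem_higherRankNumericalRange_of_isometry {k : ℕ} {A : Matrix ι ι ℂ} {z : ℂ}
    (X : Matrix ι (Fin k) ℂ) (hX : Xᴴ * X = 1) (hA : Xᴴ * A * X = z • 1) :
    z ∈ higherRankNumericalRange k A := by
  refine ⟨X * Xᴴ, ⟨?_, ?_⟩, ?_, ?_⟩
  · change X * Xᴴ * (X * Xᴴ) = X * Xᴴ
    rw [Matrix.mul_assoc, ← Matrix.mul_assoc Xᴴ, hX, Matrix.one_mul]
  · change (X * Xᴴ)ᴴ = X * Xᴴ
    rw [Matrix.conjTranspose_mul, Matrix.conjTranspose_conjTranspose]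
  · rw [Matrix.rank_self_mul_conjTranspose, ← Matrix.rank_conjTranspose_mul_self, hX,
      Matrix.rank_one, Fintype.card_fin]
  · calc X * Xᴴ * A * (X * Xᴴ) = X * (Xᴴ * A * X) * Xᴴ := by simp only [Matrix.mul_assoc]
      _ = z • (X * Xᴴ) := by rw [hA]; simp

theorem mem_higherRankNumericalRange_of_embedding {k : ℕ} {A : Matrix ι ι ℂ} {z : ℂ}
    (e : Fin k → ι) (he : Function.Injective e)
    (hA : ∀ i j, A (e i) (e j) = if i = j then z else 0) :
    z ∈ higherRankNumericalRange k A := by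
  refine mem_higherRankNumericalRange_of_isometry ((1 : Matrix ι ι ℂ).submatrix id e) ?_ ?_
  · ext i j
    simp [Matrix.mul_apply, Matrix.one_apply, he.eq_iff, eq_comm]
  · ext i j
    have : (((1 : Matrix ι ι ℂ).submatrix id e)ᴴ * A * (1 : Matrix ι ι ℂ).submatrix id e) i j =
        A (e i) (e j) := by
      simp [Matrix.mul_apply, Matrix.one_apply]
    rw [this, hA]
    simp [Matrix.one_apply]

theorem higherRankNumericalRange_subset_of_unitary {k : ℕ} (A W : Matrix ι ι ℂ) (hW : Wᴴ * W = 1) :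
    higherRankNumericalRange k A ⊆ higherRankNumericalRange k (Wᴴ * A * W) := by
  have hW' : W * Wᴴ = 1 := mul_eq_one_comm.1 hW
  rintro z ⟨P, hP, hrank, hz⟩
  have h1 : P * P = P := hP.isIdempotentElem
  have h2 : Pᴴ = P := hP.isSelfAdjoint
  refine ⟨Wᴴ * P * W, ⟨?_, ?_⟩, ?_, ?_⟩
  · change Wᴴ * P * W * (Wᴴ * P * W) = Wᴴ * P * W
    calc Wᴴ * P * W * (Wᴴ * P * W) = Wᴴ * P * (W * Wᴴ) * P * W := by simp only [Matrix.mul_assoc]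
      _ = Wᴴ * (P * P) * W := by rw [hW', Matrix.mul_one]; simp only [Matrix.mul_assoc]
      _ = _ := by rw [h1]
  · change (Wᴴ * P * W)ᴴ = Wᴴ * P * W
    simp only [Matrix.conjTranspose_mul, Matrix.conjTranspose_conjTranspose, h2, Matrix.mul_assoc]
  · have hdet : IsUnit W.det := by
      rw [← Matrix.isUnit_iff_isUnit_det]; exact IsUnit.of_mul_eq_one _ hW'
    have hdet' : IsUnit Wᴴ.det := by
      rw [← Matrix.isUnit_iff_isUnit_det]; exact IsUnit.of_mul_eq_one _ hW
    rw [Matrix.rank_mul_eq_left_of_isUnit_det _ _ hdet,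
      Matrix.rank_mul_eq_right_of_isUnit_det _ _ hdet', hrank]
  · calc Wᴴ * P * W * (Wᴴ * A * W) * (Wᴴ * P * W)
        = Wᴴ * P * (W * Wᴴ) * A * (W * Wᴴ) * P * W := by simp only [Matrix.mul_assoc]
      _ = Wᴴ * (P * A * P) * W := by
        rw [hW', Matrix.mul_one, Matrix.mul_one]; simp only [Matrix.mul_assoc]
      _ = z • (Wᴴ * P * W) := by rw [hz]; simp

theorem higherRankNumericalRange_unitary_conj {k : ℕ} (A W : Matrix ι ι ℂ) (hW : Wᴴ * W = 1) :
    higherRankNumericalRange k (Wᴴ * A * W) = higherRankNumericalRange k A := by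
  refine (Set.Subset.antisymm ?_ (higherRankNumericalRange_subset_of_unitary A W hW))
  have hW' : W * Wᴴ = 1 := mul_eq_one_comm.1 hW
  have := higherRankNumericalRange_subset_of_unitary (k := k) (Wᴴ * A * W) Wᴴ
    (by rwa [Matrix.conjTranspose_conjTranspose])
  have e : Wᴴᴴ * (Wᴴ * A * W) * Wᴴ = A := by
    rw [Matrix.conjTranspose_conjTranspose]
    calc W * (Wᴴ * A * W) * Wᴴ = (W * Wᴴ) * A * (W * Wᴴ) := by simp only [Matrix.mul_assoc]
      _ = A := by rw [hW', Matrix.one_mul, Matrix.mul_one]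
  rwa [e] at this

/-- The range of `P` has dimension `k`, too large for `f` to be injective on it, and every vector
fixed by `P` satisfies the quadratic identity. -/
theorem exists_ne_zero_of_mem_higherRankNumericalRange {k : ℕ} {A : Matrix ι ι ℂ} {z : ℂ}
    (hz : z ∈ higherRankNumericalRange k A) (f : (ι → ℂ) →ₗ[ℂ] (κ → ℂ))
    (hκ : Fintype.card κ < k) :
    ∃ x : ι → ℂ, x ≠ 0 ∧ f x = 0 ∧ star x ⬝ᵥ A *ᵥ x = z * (star x ⬝ᵥ x) := by
  obtain ⟨P, hP, hrank, hz⟩ := hz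
  have h1 : P * P = P := hP.isIdempotentElem
  have h2 : Pᴴ = P := hP.isSelfAdjoint
  have hker : LinearMap.ker (f.comp (LinearMap.range P.mulVecLin).subtype) ≠ ⊥ := by
    apply LinearMap.ker_ne_bot_of_finrank_lt
    rw [Module.finrank_fintype_fun_eq_card]
    exact hκ.trans_eq hrank.symm
  obtain ⟨⟨x, y, hy⟩, hx, hx0⟩ := Submodule.exists_mem_ne_zero_of_ne_bot hker
  have hPx : P *ᵥ x = x := by
    rw [← hy, Matrix.mulVecLin_apply, Matrix.mulVec_mulVec, h1]
  have hsPx : star x ᵥ* P = star x := by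
    conv_rhs => rw [← hPx, Matrix.star_mulVec, h2]
  refine ⟨x, fun h => hx0 (Subtype.ext h), by simpa using hx, ?_⟩
  calc star x ⬝ᵥ A *ᵥ x = star x ⬝ᵥ (P * A * P) *ᵥ x := by
        conv_lhs => rw [← hsPx, ← hPx]
        rw [← Matrix.mulVec_mulVec, ← Matrix.mulVec_mulVec, Matrix.dotProduct_mulVec (star x) P]
        rw [hPx]
    _ = z * (star x ⬝ᵥ x) := by
        rw [hz, Matrix.smul_mulVec, hPx, dotProduct_smul, smul_eq_mul]

end

/-! ### The canonical form as a sum over 2×2 blocks. -/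

/-- Extension by zero of a finite vector to a sequence. -/
def zeroExtend {m : ℕ} (y : Fin m → ℂ) (j : ℕ) : ℂ := if h : j < m then y ⟨j, h⟩ else 0

@[simp]
theorem zeroExtend_val {m : ℕ} (y : Fin m → ℂ) (i : Fin m) : zeroExtend y i = y i := by
  simp [zeroExtend]

theorem zeroExtend_of_le {m : ℕ} (y : Fin m → ℂ) {j : ℕ} (h : m ≤ j) : zeroExtend y j = 0 := by
  simp [zeroExtend, h]

theorem zeroExtend_ite {m k : ℕ} (h : k ≤ m) (j : Fin k) (c : ℂ) (n : ℕ) :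
    zeroExtend (fun l : Fin m => if l = Fin.castLE h j then c else 0) n =
      if n = j.val then c else 0 := by
  simp only [zeroExtend, Fin.ext_iff, Fin.val_castLE]
  split_ifs <;> first | rfl | omega

/-- Evaluation of the extension by zero, as a linear map. -/
def zeroExtendₗ (m j : ℕ) : (Fin m → ℂ) →ₗ[ℂ] ℂ where
  toFun y := zeroExtend y j
  map_add' x y := by simp only [zeroExtend]; split_ifs <;> simp
  map_smul' a x := by simp only [zeroExtend]; split_ifs <;> simp

theorem sum_univ_eq_sum_zeroExtend {m N : ℕ} (hN : m ≤ N) (F : ℕ → ℂ → ℂ) (hF : ∀ j, F j 0 = 0)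
    (y : Fin m → ℂ) : ∑ i : Fin m, F i (y i) = ∑ j ∈ Finset.range N, F j (zeroExtend y j) := by
  have h1 : ∑ i : Fin m, F i (y i) = ∑ i : Fin m, F i (zeroExtend y i) := by simp
  rw [h1, Fin.sum_univ_eq_sum_range fun j => F j (zeroExtend y j)]
  refine Finset.sum_subset (by simpa using hN) fun j _ hj => ?_
  rw [zeroExtend_of_le y (by simpa using hj), hF]

theorem rectDiagonal_mulVec {m n : ℕ} (s : ℕ → ℝ) (w : Fin n → ℂ) (i : Fin m) :
    (rectDiagonal m n s *ᵥ w) i = s i * zeroExtend w i := by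
  have h := sum_univ_eq_sum_zeroExtend (le_max_right (m : ℕ) n)
    (fun j c => (if i.val = j then (s i : ℂ) else 0) * c) (by simp) w
  simp only [Matrix.mulVec, dotProduct, rectDiagonal, Matrix.of_apply]
  rw [h]
  simp [i.2]

theorem conjTranspose_rectDiagonal (m n : ℕ) (s : ℕ → ℝ) :
    (rectDiagonal m n s)ᴴ = rectDiagonal n m s := by
  ext i j
  simp only [rectDiagonal, Matrix.conjTranspose_apply, Matrix.of_apply]
  by_cases h : j.val = i.val
  · simp [h]
  · simp [h, Ne.symm h]

/-- The canonical form `[[α I, S], [ζ S^*, β I]]` where `S` is diagonal. -/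
def scalarBlockMatrix (r q : ℕ) (α β ζ : ℂ) (s : ℕ → ℝ) :
    Matrix (Fin r ⊕ Fin q) (Fin r ⊕ Fin q) ℂ :=
  Matrix.fromBlocks (α • 1) (rectDiagonal r q s) (ζ • (rectDiagonal r q s)ᴴ) (β • 1)

section

variable {r q : ℕ} {α β ζ : ℂ} {s : ℕ → ℝ}

theorem star_dotProduct_self_eq_sum {N : ℕ} (hr : r ≤ N) (hq : q ≤ N) (x : Fin r ⊕ Fin q → ℂ) :
    star x ⬝ᵥ x = ((∑ j ∈ Finset.range N, (‖zeroExtend (x ∘ Sum.inl) j‖ ^ 2 +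
      ‖zeroExtend (x ∘ Sum.inr) j‖ ^ 2) : ℝ) : ℂ) := by
  have h1 := sum_univ_eq_sum_zeroExtend hr (fun _ c => (starRingEnd ℂ) c * c) (by simp)
    (x ∘ Sum.inl)
  have h2 := sum_univ_eq_sum_zeroExtend hq (fun _ c => (starRingEnd ℂ) c * c) (by simp)
    (x ∘ Sum.inr)
  simp only [Function.comp_apply, Complex.conj_mul'] at h1 h2
  simp only [dotProduct, Fintype.sum_sum_type, Pi.star_apply, RCLike.star_def, Complex.conj_mul']
  rw [h1, h2]
  push_cast
  rw [Finset.sum_add_distrib]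

/-- Padding both halves of `x` to a common length pairs the `j`-th coordinates, and an unpaired
coordinate simply gets the partner `0`; no case split on `r` versus `q` is needed. -/
theorem star_dotProduct_scalarBlockMatrix_mulVec {N : ℕ} (hr : r ≤ N) (hq : q ≤ N)
    (x : Fin r ⊕ Fin q → ℂ) :
    star x ⬝ᵥ scalarBlockMatrix r q α β ζ s *ᵥ x =
      ∑ j ∈ Finset.range N,
        (α * ‖zeroExtend (x ∘ Sum.inl) j‖ ^ 2 + β * ‖zeroExtend (x ∘ Sum.inr) j‖ ^ 2 +
          s j * ((starRingEnd ℂ) (zeroExtend (x ∘ Sum.inl) j) * zeroExtend (x ∘ Sum.inr) j +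
            ζ * ((starRingEnd ℂ) (zeroExtend (x ∘ Sum.inr) j) *
              zeroExtend (x ∘ Sum.inl) j))) := by
  have h1 := sum_univ_eq_sum_zeroExtend hr (fun j c => (starRingEnd ℂ) c *
    (α * c + s j * zeroExtend (x ∘ Sum.inr) j)) (by simp) (x ∘ Sum.inl)
  have h2 := sum_univ_eq_sum_zeroExtend hq (fun j c => (starRingEnd ℂ) c *
    (ζ * (s j * zeroExtend (x ∘ Sum.inl) j) + β * c)) (by simp) (x ∘ Sum.inr)
  rw [scalarBlockMatrix, Matrix.fromBlocks_mulVec, conjTranspose_rectDiagonal]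
  simp only [dotProduct, Fintype.sum_sum_type, Pi.star_apply, RCLike.star_def, Sum.elim_inl,
    Sum.elim_inr, Pi.add_apply, Matrix.smul_mulVec, Pi.smul_apply, Matrix.one_mulVec,
    rectDiagonal_mulVec, smul_eq_mul, Function.comp_apply] at h1 h2 ⊢
  rw [h1, h2, ← Finset.sum_add_distrib]
  refine Finset.sum_congr rfl fun j _ => ?_
  rw [← Complex.conj_mul', ← Complex.conj_mul']
  ring

theorem eq_zero_of_zeroExtend (x : Fin r ⊕ Fin q → ℂ)
    (h1 : ∀ j, zeroExtend (x ∘ Sum.inl) j = 0) (h2 : ∀ j, zeroExtend (x ∘ Sum.inr) j = 0) :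
    x = 0 := by
  funext i
  rcases i with i | i
  · simpa using h1 i
  · simpa using h2 i

theorem sum_zeroExtend_pos {N : ℕ} (hr : r ≤ N) (hq : q ≤ N) {x : Fin r ⊕ Fin q → ℂ}
    (hx : x ≠ 0) :
    0 < ∑ j ∈ Finset.range N, (‖zeroExtend (x ∘ Sum.inl) j‖ ^ 2 +
      ‖zeroExtend (x ∘ Sum.inr) j‖ ^ 2) := by
  refine lt_of_le_of_ne (Finset.sum_nonneg fun j _ => by positivity) fun h => hx ?_
  have h0 : star x ⬝ᵥ x = 0 := by
    rw [star_dotProduct_self_eq_sum hr hq, ← h, Complex.ofReal_zero]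
  open ComplexOrder in exact dotProduct_star_self_eq_zero.1 h0

/-! ### The range for `k` at most the smaller block size. -/

theorem re_mul_block_form (u γ ζ a b : ℂ) (s : ℝ) :
    (u * (γ * ((‖a‖ ^ 2 - ‖b‖ ^ 2 : ℝ) : ℂ) + s * ((starRingEnd ℂ) a * b +
      ζ * ((starRingEnd ℂ) b * a)))).re =
      (u * γ).re * (‖a‖ ^ 2 - ‖b‖ ^ 2) +
        s * ((u + (starRingEnd ℂ) (u * ζ)) * ((starRingEnd ℂ) a * b)).re := by
  have : u * (γ * ((‖a‖ ^ 2 - ‖b‖ ^ 2 : ℝ) : ℂ) + s * ((starRingEnd ℂ) a * b +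
      ζ * ((starRingEnd ℂ) b * a))) = ((‖a‖ ^ 2 - ‖b‖ ^ 2 : ℝ) : ℂ) * (u * γ) +
        (s : ℂ) * (u * ((starRingEnd ℂ) a * b) + u * ζ * ((starRingEnd ℂ) b * a)) := by ring
  rw [this, Complex.add_re, Complex.re_ofReal_mul, Complex.re_ofReal_mul]
  simp only [Complex.add_re, Complex.add_im, Complex.mul_re, Complex.mul_im, Complex.conj_re,
    Complex.conj_im]
  ring

/-- Cauchy–Schwarz combined with `(y² + w²)² = (y² - w²)² + (2yw)²`; `h` is the top eigenvalue of
the Hermitian matrix with diagonal `±d` and off-diagonal entries `t * c / 2`. -/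
theorem block_form_le {d c s t h y w : ℝ} (hst : s ≤ t) (hy : 0 ≤ y) (hw : 0 ≤ w)
    (hc : 0 ≤ c) (h0 : 0 ≤ h) (hh : h ^ 2 = d ^ 2 + t ^ 2 * c ^ 2 / 4) :
    d * (y ^ 2 - w ^ 2) + s * (c * (y * w)) ≤ h * (y ^ 2 + w ^ 2) := by
  have h1 : s * (c * (y * w)) ≤ t * (c * (y * w)) := by gcongr
  refine le_trans (add_le_add_right h1 _) ?_
  apply le_of_sq_le_sq _ (by positivity)
  have e : (h * (y ^ 2 + w ^ 2)) ^ 2 - (d * (y ^ 2 - w ^ 2) + t * (c * (y * w))) ^ 2 =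
      (2 * d * (y * w) - t * c / 2 * (y ^ 2 - w ^ 2)) ^ 2 := by
    rw [mul_pow, hh]; ring
  nlinarith [sq_nonneg (2 * d * (y * w) - t * c / 2 * (y ^ 2 - w ^ 2))]

theorem sub_mem_blockSupportSet_of_mem_higherRankNumericalRange (hs : Antitone s)
    (hs0 : ∀ j, 0 ≤ s j) {k : ℕ} {z : ℂ}
    (hz : z ∈ higherRankNumericalRange (k + 1) (scalarBlockMatrix r q α β ζ s)) :
    z - (α + β) / 2 ∈ blockSupportSet ((α - β) / 2) ζ (s k) := by
  set γ := (α - β) / 2 with hγ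
  set c := (α + β) / 2 with hc
  have key : ∀ u : ℂ, ‖u‖ = 1 → (u * (z - c)).re ≤
      √((u * γ).re ^ 2 + s k ^ 2 * ‖u + (starRingEnd ℂ) (u * ζ)‖ ^ 2 / 4) := by
    intro u hu
    set κ := u + (starRingEnd ℂ) (u * ζ)
    set h := √((u * γ).re ^ 2 + s k ^ 2 * ‖κ‖ ^ 2 / 4)
    have hh : h ^ 2 = (u * γ).re ^ 2 + s k ^ 2 * ‖κ‖ ^ 2 / 4 := Real.sq_sqrt (by positivity)
    have h0 : 0 ≤ h := Real.sqrt_nonneg _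
    obtain ⟨v, hv, hvκ⟩ := exists_unit_mul_eq_norm κ
    -- One equation `Y j = -(conj v * W j)` for each of the `k` largest blocks. It equalises the
    -- moduli, cancelling the diagonal part, and the phase `v` makes the cross term `-s j * ‖κ‖ * ‖W
    -- j‖ ^ 2 ≤ 0`. The remaining blocks have `s j ≤ s k`.
    let f : (Fin r ⊕ Fin q → ℂ) →ₗ[ℂ] (Fin k → ℂ) := LinearMap.pi fun j =>
      (zeroExtendₗ r j).comp (LinearMap.funLeft ℂ ℂ Sum.inl) +
        (starRingEnd ℂ) v • (zeroExtendₗ q j).comp (LinearMap.funLeft ℂ ℂ Sum.inr)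
    obtain ⟨x, hx0, hfx, hx⟩ := exists_ne_zero_of_mem_higherRankNumericalRange hz f (by simp)
    have hr : r ≤ r + q := by omega
    have hq : q ≤ r + q := by omega
    have hpos := sum_zeroExtend_pos hr hq hx0
    rw [star_dotProduct_scalarBlockMatrix_mulVec hr hq, star_dotProduct_self_eq_sum hr hq] at hx
    set Y := zeroExtend (x ∘ Sum.inl)
    set W := zeroExtend (x ∘ Sum.inr)
    have hYW : ∀ j < k, Y j = -((starRingEnd ℂ) v * W j) := by
      intro j hj
      exact eq_neg_of_add_eq_zero_left (congrFun hfx ⟨j, hj⟩)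
    set n := ∑ j ∈ Finset.range (r + q), (‖Y j‖ ^ 2 + ‖W j‖ ^ 2) with hn
    have hsum : (n : ℂ) * (u * (z - c)) = ∑ j ∈ Finset.range (r + q),
        u * (γ * ((‖Y j‖ ^ 2 - ‖W j‖ ^ 2 : ℝ) : ℂ) + s j * ((starRingEnd ℂ) (Y j) * W j +
          ζ * ((starRingEnd ℂ) (W j) * Y j))) := by
      rw [← Finset.mul_sum]
      have : (n : ℂ) * (u * (z - c)) = u * (z * n - c * n) := by ring
      rw [this, ← hx, hn]
      push_cast
      rw [Finset.mul_sum, ← Finset.sum_sub_distrib]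
      congr 1
      refine Finset.sum_congr rfl fun j _ => ?_
      rw [hγ, hc]; ring
    have hle : n * (u * (z - c)).re ≤ n * h := by
      rw [← Complex.re_ofReal_mul, hsum, Complex.re_sum, mul_comm, hn, Finset.mul_sum]
      refine Finset.sum_le_sum fun j _ => ?_
      rw [re_mul_block_form]
      rcases lt_or_ge j k with hj | hj
      · have e1 : ‖Y j‖ = ‖W j‖ := by rw [hYW j hj]; simp [hv]
        have e2 : κ * ((starRingEnd ℂ) (Y j) * W j) = -((‖κ‖ * ‖W j‖ ^ 2 : ℝ) : ℂ) := by
          rw [hYW j hj, map_neg, map_mul, Complex.conj_conj]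
          push_cast
          rw [← hvκ, ← Complex.conj_mul']; ring
        have e3 : 0 ≤ s j * (‖κ‖ * ‖W j‖ ^ 2) := mul_nonneg (hs0 j) (by positivity)
        have e4 : 0 ≤ h * (‖W j‖ ^ 2 + ‖W j‖ ^ 2) := by positivity
        rw [e1, e2, Complex.neg_re, Complex.ofReal_re]
        linarith
      · refine le_trans ?_ (block_form_le (hs hj) (norm_nonneg (Y j)) (norm_nonneg (W j))
          (norm_nonneg κ) h0 hh)
        have e1 : (κ * ((starRingEnd ℂ) (Y j) * W j)).re ≤ ‖κ‖ * (‖Y j‖ * ‖W j‖) := by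
          refine (Complex.re_le_norm _).trans ?_
          simp
        have := mul_le_mul_of_nonneg_left e1 (hs0 j)
        linarith
    exact le_of_mul_le_mul_left hle hpos
  intro u hu
  have h1 := key u hu
  -- The bound is even in `u`, so the opposite direction gives the lower estimate needed for the
  -- square.
  have h2 := key (-u) (by simpa using hu)
  have e : ‖-u + (starRingEnd ℂ) (-u * ζ)‖ = ‖u + (starRingEnd ℂ) (u * ζ)‖ := by
    rw [← norm_neg]; congr 1; simp; ring
  rw [e, neg_mul, neg_mul, Complex.neg_re, Complex.neg_re, neg_sq] at h2
  exact (sq_le_sq' (by linarith) h1).trans_eq (Real.sq_sqrt (by positivity))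

theorem mem_higherRankNumericalRange_of_sub_mem_blockSupportSet (hs : Antitone s)
    (hs0 : ∀ j, 0 ≤ s j) {k : ℕ} (hr : k + 1 ≤ r) (hq : k + 1 ≤ q) {z : ℂ}
    (hz : z - (α + β) / 2 ∈ blockSupportSet ((α - β) / 2) ζ (s k)) :
    z ∈ higherRankNumericalRange (k + 1) (scalarBlockMatrix r q α β ζ s) := by
  have h : ∀ j : Fin (k + 1), ∃ a b : ℂ, ‖a‖ ^ 2 + ‖b‖ ^ 2 = 1 ∧
      (α - β) / 2 * ((‖a‖ ^ 2 - ‖b‖ ^ 2 : ℝ) : ℂ) + s j * ((starRingEnd ℂ) a * b +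
        ζ * ((starRingEnd ℂ) b * a)) = z - (α + β) / 2 := fun j =>
    exists_unit_vector_of_mem_blockSupportSet
      (blockSupportSet_mono (hs0 k) (hs (Nat.lt_succ_iff.1 j.2)) hz)
  choose a b hab hform using h
  have habC : ∀ j, (starRingEnd ℂ) (a j) * a j + (starRingEnd ℂ) (b j) * b j = 1 := by
    intro j
    rw [Complex.conj_mul', Complex.conj_mul']
    exact_mod_cast hab j
  have hvalue : ∀ j, (starRingEnd ℂ) (a j) * (α * a j + s j * b j) +
      (starRingEnd ℂ) (b j) * (ζ * (s j * a j) + β * b j) = z := by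
    intro j
    have h1 := hform j
    push_cast at h1
    rw [← Complex.conj_mul', ← Complex.conj_mul'] at h1
    linear_combination h1 + (α + β) / 2 * habC j
  -- Column `j` lives in block `j` alone, so distinct columns are orthogonal and remain so after
  -- applying the matrix.
  let X : Matrix (Fin r ⊕ Fin q) (Fin (k + 1)) ℂ := Matrix.of fun i j =>
    Sum.elim (fun l => if l = Fin.castLE hr j then a j else 0)
      (fun l => if l = Fin.castLE hq j then b j else 0) i
  have hAX : ∀ j, scalarBlockMatrix r q α β ζ s *ᵥ (fun i => X i j) =
      Sum.elim (fun l => if l = Fin.castLE hr j then α * a j + s j * b j else 0)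
      (fun l => if l = Fin.castLE hq j then ζ * (s j * a j) + β * b j else 0) := by
    intro j
    have e1 : (fun i => X i j) ∘ Sum.inl = fun l => if l = Fin.castLE hr j then a j else 0 := rfl
    have e2 : (fun i => X i j) ∘ Sum.inr = fun l => if l = Fin.castLE hq j then b j else 0 := rfl
    rw [scalarBlockMatrix, Matrix.fromBlocks_mulVec, conjTranspose_rectDiagonal, e1, e2]
    congr 1
    · funext l
      simp only [Pi.add_apply, Matrix.smul_mulVec, Pi.smul_apply, Matrix.one_mulVec, smul_eq_mul,
        rectDiagonal_mulVec, zeroExtend_ite]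
      simp only [Fin.ext_iff, Fin.val_castLE]
      split_ifs with h <;> simp [h]
    · funext l
      simp only [Pi.add_apply, Matrix.smul_mulVec, Pi.smul_apply, Matrix.one_mulVec, smul_eq_mul,
        rectDiagonal_mulVec, zeroExtend_ite]
      simp only [Fin.ext_iff, Fin.val_castLE]
      split_ifs with h <;> simp [h]
  have hcol : ∀ i j, (Xᴴ * scalarBlockMatrix r q α β ζ s * X) i j =
      star (fun l => X l i) ⬝ᵥ (scalarBlockMatrix r q α β ζ s *ᵥ (fun l => X l j)) := by
    intro i j
    rw [Matrix.mul_assoc]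
    rfl
  refine mem_higherRankNumericalRange_of_isometry X ?_ ?_
  · ext i j
    have : (Xᴴ * X) i j = star (fun l => X l i) ⬝ᵥ (fun l => X l j) := rfl
    rw [this]
    rcases eq_or_ne i j with h | h
    · subst h
      simpa [dotProduct, X, apply_ite] using habC i
    · have h' : ¬ j = i := Ne.symm h
      simp [dotProduct, X, apply_ite, h, h']
  · ext i j
    rw [hcol, hAX]
    rcases eq_or_ne i j with h | h
    · subst h
      simpa [dotProduct, X, apply_ite] using hvalue i
    · have h' : ¬ j = i := Ne.symm h
      simp [dotProduct, X, apply_ite, h, h']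

end

/-! ### Large `k`, and the case of equal diagonal scalars. -/

section

variable {r q : ℕ} {α β ζ : ℂ} {s : ℕ → ℝ}

theorem eq_left_of_mem_higherRankNumericalRange {k : ℕ} {z : ℂ} (hk : q < k)
    (hz : z ∈ higherRankNumericalRange k (scalarBlockMatrix r q α β ζ s)) : z = α := by
  obtain ⟨x, hx0, hfx, hx⟩ := exists_ne_zero_of_mem_higherRankNumericalRange hz
    (LinearMap.funLeft ℂ ℂ (Sum.inr : Fin q → Fin r ⊕ Fin q)) (by simpa using hk)
  have hr : r ≤ r + q := by omega
  have hq : q ≤ r + q := by omega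
  have hpos := sum_zeroExtend_pos hr hq hx0
  rw [star_dotProduct_scalarBlockMatrix_mulVec hr hq, star_dotProduct_self_eq_sum hr hq] at hx
  have hW : ∀ j, zeroExtend (x ∘ Sum.inr) j = 0 := by
    intro j
    have : x ∘ Sum.inr = 0 := hfx
    rw [this]; simp [zeroExtend]
  simp only [hW] at hx hpos
  have hne := Complex.ofReal_ne_zero.2 hpos.ne'
  apply mul_right_cancel₀ hne
  rw [← hx]
  push_cast
  rw [Finset.mul_sum]
  exact Finset.sum_congr rfl fun j _ => by simp

theorem eq_right_of_mem_higherRankNumericalRange {k : ℕ} {z : ℂ} (hk : r < k)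
    (hz : z ∈ higherRankNumericalRange k (scalarBlockMatrix r q α β ζ s)) : z = β := by
  obtain ⟨x, hx0, hfx, hx⟩ := exists_ne_zero_of_mem_higherRankNumericalRange hz
    (LinearMap.funLeft ℂ ℂ (Sum.inl : Fin r → Fin r ⊕ Fin q)) (by simpa using hk)
  have hr : r ≤ r + q := by omega
  have hq : q ≤ r + q := by omega
  have hpos := sum_zeroExtend_pos hr hq hx0
  rw [star_dotProduct_scalarBlockMatrix_mulVec hr hq, star_dotProduct_self_eq_sum hr hq] at hx
  have hY : ∀ j, zeroExtend (x ∘ Sum.inl) j = 0 := by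
    intro j
    have : x ∘ Sum.inl = 0 := hfx
    rw [this]; simp [zeroExtend]
  simp only [hY] at hx hpos
  have hne := Complex.ofReal_ne_zero.2 hpos.ne'
  apply mul_right_cancel₀ hne
  rw [← hx]
  push_cast
  rw [Finset.mul_sum]
  exact Finset.sum_congr rfl fun j _ => by simp

theorem left_mem_higherRankNumericalRange {k : ℕ} (hk : k ≤ r) :
    α ∈ higherRankNumericalRange k (scalarBlockMatrix r q α β ζ s) := by
  refine mem_higherRankNumericalRange_of_embedding (fun i => Sum.inl (Fin.castLE hk i))
    (Sum.inl_injective.comp (Fin.castLE_injective hk)) fun i j => ?_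
  simp [scalarBlockMatrix, Matrix.one_apply]

theorem right_mem_higherRankNumericalRange {k : ℕ} (hk : k ≤ q) :
    β ∈ higherRankNumericalRange k (scalarBlockMatrix r q α β ζ s) := by
  refine mem_higherRankNumericalRange_of_embedding (fun i => Sum.inr (Fin.castLE hk i))
    (Sum.inr_injective.comp (Fin.castLE_injective hk)) fun i j => ?_
  simp [scalarBlockMatrix, Matrix.one_apply]

/-- Discarding the first `p` coordinates of the second half removes every nonzero off-diagonal
entry, leaving a principal submatrix `α • 1`. -/
theorem mem_higherRankNumericalRange_scalarBlockMatrix_self {k p : ℕ}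
    (hs : ∀ j, p ≤ j → s j = 0) (hk : k ≤ r + (q - p)) :
    α ∈ higherRankNumericalRange k (scalarBlockMatrix r q α α ζ s) := by
  let g : Fin r ⊕ Fin (q - p) → Fin r ⊕ Fin q :=
    Sum.map id fun i => ⟨p + i.val, by omega⟩
  have hg : Function.Injective g := by
    refine Function.Injective.sumMap Function.injective_id fun i j h => ?_
    simpa [Fin.ext_iff] using h
  have hform : ∀ i j, scalarBlockMatrix r q α α ζ s (g i) (g j) = if i = j then α else 0 := by
    have hrect : ∀ (i : Fin r) (j : Fin (q - p)) (h : p + j.val < q),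
        rectDiagonal r q s i ⟨p + j.val, h⟩ = 0 := by
      intro i j h
      simp only [rectDiagonal, Matrix.of_apply]
      split_ifs with hij
      · rw [hs _ (by omega), Complex.ofReal_zero]
      · rfl
    rintro (i | i) (j | j)
    · simp [g, scalarBlockMatrix, Matrix.one_apply]
    · simp [g, scalarBlockMatrix, hrect]
    · simp [g, scalarBlockMatrix, hrect]
    · simp [g, scalarBlockMatrix, Matrix.one_apply, Fin.ext_iff]
  refine mem_higherRankNumericalRange_of_embedding
    (fun i => g (finSumFinEquiv.symm (Fin.castLE hk i)))
    (hg.comp (finSumFinEquiv.symm.injective.comp (Fin.castLE_injective hk))) fun i j => ?_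
  rw [hform]
  simp

theorem exists_unit_add_mul_conj_ne_zero (ζ : ℂ) :
    ∃ ω : ℂ, ‖ω‖ = 1 ∧ (starRingEnd ℂ) ω + ζ * ω ≠ 0 := by
  by_cases h : ζ = -1
  · refine ⟨Complex.I, Complex.norm_I, ?_⟩
    rw [h, Complex.conj_I]
    simp [← two_mul]
  · refine ⟨1, norm_one, fun h1 => h ?_⟩
    rw [map_one, mul_one] at h1
    exact eq_neg_of_add_eq_zero_right h1

/-- On the subspace `Y = -ω W` with `W j = 0` for `j ≥ p`, the form minus `α ‖x‖²` is a nonzero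
constant times `∑ s j * ‖W j‖ ^ 2`. Since `z = α` is forced, this sum vanishes, and then so does
`x`. -/
theorem higherRankNumericalRange_scalarBlockMatrix_self_eq_empty {k p : ℕ}
    (hpos : ∀ j < p, 0 < s j) (hs : ∀ j, p ≤ j → s j = 0) (hpr : p ≤ r) (hrk : r < k)
    (hk : r + (q - p) < k) :
    higherRankNumericalRange k (scalarBlockMatrix r q α α ζ s) = ∅ := by
  refine Set.eq_empty_of_forall_notMem fun z hz => ?_
  have hzα : z = α := eq_right_of_mem_higherRankNumericalRange hrk hz
  obtain ⟨ω, hω, hωζ⟩ := exists_unit_add_mul_conj_ne_zero ζ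
  let f : (Fin r ⊕ Fin q → ℂ) →ₗ[ℂ] (Fin r ⊕ Fin (q - p) → ℂ) := LinearMap.pi fun j =>
    Sum.elim (fun i : Fin r => (zeroExtendₗ r i).comp (LinearMap.funLeft ℂ ℂ Sum.inl) +
        ω • (zeroExtendₗ q i).comp (LinearMap.funLeft ℂ ℂ Sum.inr))
      (fun i : Fin (q - p) => (zeroExtendₗ q (p + i)).comp (LinearMap.funLeft ℂ ℂ Sum.inr)) j
  obtain ⟨x, hx0, hfx, hx⟩ := exists_ne_zero_of_mem_higherRankNumericalRange hz f (by simpa using hk)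
  have hr : r ≤ r + q := by omega
  have hq : q ≤ r + q := by omega
  rw [star_dotProduct_scalarBlockMatrix_mulVec hr hq, star_dotProduct_self_eq_sum hr hq, hzα] at hx
  apply hx0
  set Y := zeroExtend (x ∘ Sum.inl) with hY
  set W := zeroExtend (x ∘ Sum.inr) with hW
  have hWp : ∀ j, p ≤ j → W j = 0 := by
    intro j hj
    rcases lt_or_ge j q with hjq | hjq
    · have := congrFun hfx (Sum.inr ⟨j - p, by omega⟩)
      have h2 : W (p + (j - p)) = 0 := this
      rwa [Nat.add_sub_cancel' hj] at h2
    · exact zeroExtend_of_le _ hjq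
  have hYW : ∀ j, Y j = -(ω * W j) := by
    intro j
    rcases lt_or_ge j r with hjr | hjr
    · exact eq_neg_of_add_eq_zero_left (congrFun hfx (Sum.inl ⟨j, hjr⟩))
    · rw [hWp j (by omega), mul_zero, neg_zero]
      exact zeroExtend_of_le _ hjr
  have hzero : ((∑ j ∈ Finset.range (r + q), s j * ‖W j‖ ^ 2 : ℝ) : ℂ) = 0 := by
    have e : ∑ j ∈ Finset.range (r + q), (α * ‖Y j‖ ^ 2 + α * ‖W j‖ ^ 2 + s j *
        ((starRingEnd ℂ) (Y j) * W j + ζ * ((starRingEnd ℂ) (W j) * Y j))) =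
        α * ((∑ j ∈ Finset.range (r + q), (‖Y j‖ ^ 2 + ‖W j‖ ^ 2) : ℝ) : ℂ) -
          ((starRingEnd ℂ) ω + ζ * ω) *
            ((∑ j ∈ Finset.range (r + q), s j * ‖W j‖ ^ 2 : ℝ) : ℂ) := by
      push_cast
      rw [Finset.mul_sum, Finset.mul_sum, ← Finset.sum_sub_distrib]
      refine Finset.sum_congr rfl fun j _ => ?_
      have : (starRingEnd ℂ) (Y j) * W j + ζ * ((starRingEnd ℂ) (W j) * Y j) =
          -((starRingEnd ℂ) ω + ζ * ω) * (‖W j‖ : ℂ) ^ 2 := by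
        rw [hYW j, ← Complex.conj_mul', map_neg, map_mul]; ring
      rw [this]; ring
    rw [e, sub_eq_self] at hx
    exact (mul_eq_zero.1 hx).resolve_left hωζ
  have hs0 : ∀ j, 0 ≤ s j := fun j =>
    (lt_or_ge j p).elim (fun h => (hpos j h).le) fun h => (hs j h).ge
  have hW0 : ∀ j, W j = 0 := by
    intro j
    rcases lt_or_ge j p with hj | hj
    · have h1 := (Finset.sum_eq_zero_iff_of_nonneg fun j _ =>
        mul_nonneg (hs0 j) (sq_nonneg ‖W j‖)).1 (Complex.ofReal_eq_zero.1 hzero) j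
          (Finset.mem_range.2 (by omega))
      have h2 := (mul_eq_zero.1 h1).resolve_left (hpos j hj).ne'
      simpa using h2
    · exact hWp j hj
  exact eq_zero_of_zeroExtend x (fun j => by rw [← hY, hYW, hW0, mul_zero, neg_zero]) hW0

theorem mem_higherRankNumericalRange_scalarBlockMatrix_iff (hs : Antitone s) (hs0 : ∀ j, 0 ≤ s j)
    {k : ℕ} (hk : 0 < k) (hr : k ≤ r) (hq : k ≤ q) {z : ℂ} :
    z ∈ higherRankNumericalRange k (scalarBlockMatrix r q α β ζ s) ↔
      z - (α + β) / 2 ∈ blockSupportSet ((α - β) / 2) ζ (s (k - 1)) := by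
  obtain ⟨k, rfl⟩ := Nat.exists_eq_add_of_lt hk
  rw [zero_add] at *
  exact ⟨sub_mem_blockSupportSet_of_mem_higherRankNumericalRange hs hs0,
    mem_higherRankNumericalRange_of_sub_mem_blockSupportSet hs hs0 hr hq⟩

end

/-! ### Reduction to canonical form and assembly. -/

theorem finrank_range_toEuclideanLin {m n : ℕ} (C : Matrix (Fin m) (Fin n) ℂ) :
    Module.finrank ℂ (LinearMap.range (Matrix.toEuclideanLin C)) = C.rank := by
  change Module.finrank ℂ (LinearMap.range (Matrix.toLpLin 2 2 C)) = C.rank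
  rw [Matrix.toLpLin_eq_toLin, ← Matrix.rank_eq_finrank_range_toLin]

theorem higherRankNumericalRange_fromBlocks {r q : ℕ} (k : ℕ) (α β ζ : ℂ)
    (C : Matrix (Fin r) (Fin q) ℂ) :
    higherRankNumericalRange k (Matrix.fromBlocks (α • (1 : Matrix (Fin r) (Fin r) ℂ)) C
      (ζ • Cᴴ) (β • (1 : Matrix (Fin q) (Fin q) ℂ))) =
    higherRankNumericalRange k
      (scalarBlockMatrix r q α β ζ (Matrix.toEuclideanLin C).singularValues) := by
  obtain ⟨U, V, hU, hV, hC⟩ := exists_singular_value_decomposition C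
  have hW : (Matrix.fromBlocks U 0 0 V)ᴴ * Matrix.fromBlocks U 0 0 V = 1 := by
    simp [Matrix.fromBlocks_conjTranspose, Matrix.fromBlocks_multiply, hU, hV]
  rw [← higherRankNumericalRange_unitary_conj _ _ hW]
  congr 1
  have hC' : Vᴴ * Cᴴ * U = (rectDiagonal r q (Matrix.toEuclideanLin C).singularValues)ᴴ := by
    rw [← hC]
    simp only [Matrix.conjTranspose_mul, Matrix.conjTranspose_conjTranspose, Matrix.mul_assoc]
  simp [Matrix.fromBlocks_conjTranspose, Matrix.fromBlocks_multiply, scalarBlockMatrix, hU, hV, hC,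
    hC']

theorem isEllipticalDisc_of_mem_iff {S : Set ℂ} {α β ζ δ Δ : ℂ} {s : ℝ}
    (hΔ : Δ = (α - β) ^ 2 + 4 * ζ * (s : ℂ) ^ 2) (hδ : δ ^ 2 = Δ)
    (hS : ∀ z, z ∈ S ↔ z - (α + β) / 2 ∈ blockSupportSet ((α - β) / 2) ζ s) :
    IsEllipticalDisc S ((α + β) / 2 + δ / 2) ((α + β) / 2 - δ / 2)
      (√(‖α - β‖ ^ 2 / 2 + (1 + ‖ζ‖ ^ 2) * s ^ 2 + ‖Δ‖ / 2))
      (√(‖α - β‖ ^ 2 / 2 + (1 + ‖ζ‖ ^ 2) * s ^ 2 - ‖Δ‖ / 2)) := by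
  -- Makes the radicand of the minor axis nonnegative; it rests on `2 * ‖ζ‖ ≤ 1 + ‖ζ‖ ^ 2`.
  have hΔle : ‖Δ‖ ≤ ‖α - β‖ ^ 2 + 2 * (1 + ‖ζ‖ ^ 2) * s ^ 2 := by
    rw [hΔ]
    refine (norm_add_le _ _).trans ?_
    simp only [norm_pow, norm_mul, Complex.norm_real, Real.norm_eq_abs, sq_abs, Complex.norm_ofNat]
    nlinarith [mul_nonneg (sq_nonneg (1 - ‖ζ‖)) (sq_nonneg s)]
  have hδ2 : ‖δ‖ ^ 2 = ‖Δ‖ := by rw [← hδ, norm_pow]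
  set N : ℝ := ‖(α - β) / 2‖ ^ 2 + s ^ 2 * (1 + ‖ζ‖ ^ 2) / 2 with hN
  have hhalf : ∀ w : ℂ, ‖w / 2‖ ^ 2 = ‖w‖ ^ 2 / 4 := by
    intro w; rw [norm_div, div_pow]; norm_num
  refine ⟨Real.sqrt_nonneg _, Real.sqrt_nonneg _, ?_, ?_⟩
  · have hd : dist ((α + β) / 2 + δ / 2) ((α + β) / 2 - δ / 2) = ‖δ‖ := by
      rw [dist_eq_norm]; congr 1; ring
    rw [hd, hδ2, Real.sq_sqrt (by positivity), Real.sq_sqrt (by linarith)]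
    ring
  · ext z
    rw [hS, mem_blockSupportSet_iff, Set.mem_ofPred_eq]
    have hf : ((α - β) / 2) ^ 2 + ζ * (s : ℂ) ^ 2 = (δ / 2) ^ 2 := by
      rw [div_pow δ, hδ, hΔ]; ring
    have ha : ‖α - β‖ ^ 2 / 2 + (1 + ‖ζ‖ ^ 2) * s ^ 2 + ‖Δ‖ / 2 = 2 * N + 2 * ‖δ / 2‖ ^ 2 := by
      rw [hN, hhalf, hhalf, hδ2]; ring
    have e1 : dist z ((α + β) / 2 + δ / 2) = ‖z - (α + β) / 2 - δ / 2‖ := by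
      rw [dist_eq_norm]; congr 1; ring
    have e2 : dist z ((α + β) / 2 - δ / 2) = ‖z - (α + β) / 2 + δ / 2‖ := by
      rw [dist_eq_norm]; congr 1; ring
    rw [hf, ha, e1, e2, norm_sub_add_norm_add_le_sqrt_iff (by positivity)]

theorem corollary3p3 (n r p m M : ℕ) (hr : 0 < r) (hrn : r < n)
    (α β ζ : ℂ) (C : Matrix (Fin r) (Fin (n - r)) ℂ) (D : Matrix (Fin (n - r)) (Fin r) ℂ)
    (hD : D = ζ • Cᴴ)
    (A : Matrix (Fin r ⊕ Fin (n - r)) (Fin r ⊕ Fin (n - r)) ℂ)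
    (hA : A = Matrix.fromBlocks (α • (1 : Matrix (Fin r) (Fin r) ℂ)) C
      D (β • (1 : Matrix (Fin (n - r)) (Fin (n - r)) ℂ)))
    (hp : p = C.rank) (hm : m = min (n - r) r) (hM : M = max (n - r) r) :
    -- elliptical discs; `δ` is either square root of `Δ`
    (∀ k : ℕ, 1 ≤ k → k ≤ p → ∀ Δ δ : ℂ,
      Δ = (α - β) ^ 2 + 4 * ζ * (matrixSingularValue C k : ℂ) ^ 2 → δ ^ 2 = Δ →
      IsEllipticalDisc (higherRankNumericalRange k A)
        ((α + β) / 2 + δ / 2) ((α + β) / 2 - δ / 2)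
        (Real.sqrt (‖α - β‖ ^ 2 / 2 + (1 + ‖ζ‖ ^ 2) * matrixSingularValue C k ^ 2 + ‖Δ‖ / 2))
        (Real.sqrt (‖α - β‖ ^ 2 / 2 + (1 + ‖ζ‖ ^ 2) * matrixSingularValue C k ^ 2 - ‖Δ‖ / 2)))
    ∧ (∀ k : ℕ, p < k → k ≤ m → higherRankNumericalRange k A = segment ℝ α β)
    ∧ (n < 2 * r → ∀ k : ℕ, m < k → k ≤ M → higherRankNumericalRange k A = {α})
    ∧ (2 * r < n → ∀ k : ℕ, m < k → k ≤ M → higherRankNumericalRange k A = {β})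
    ∧ (α ≠ β → ∀ k : ℕ, M < k → k ≤ n → higherRankNumericalRange k A = ∅)
    -- the same range of `k` in the case `α = β`
    ∧ (α = β → ∀ k : ℕ, M < k → k ≤ n - p → higherRankNumericalRange k A = {α})
    ∧ (α = β → ∀ k : ℕ, n - p < k → k ≤ n → higherRankNumericalRange k A = ∅) := by
  subst hD hA
  simp only [higherRankNumericalRange_fromBlocks]
  have hs : Antitone (Matrix.toEuclideanLin C).singularValues :=
    (Matrix.toEuclideanLin C).singularValues_antitone
  have hs0 := (Matrix.toEuclideanLin C).singularValues_nonneg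
  have hpr : p ≤ r := hp ▸ C.rank_le_height
  have hpq : p ≤ n - r := hp ▸ C.rank_le_width
  have hzero : ∀ j, p ≤ j → (Matrix.toEuclideanLin C).singularValues j = 0 := by
    intro j hj
    rw [LinearMap.singularValues_eq_zero_iff_le_finrank_range, finrank_range_toEuclideanLin]
    omega
  have hpos : ∀ j < p, 0 < (Matrix.toEuclideanLin C).singularValues j := by
    intro j hj
    rw [LinearMap.singularValues_pos_iff_lt_finrank_range, finrank_range_toEuclideanLin]
    omega
  refine ⟨?_, ?_, ?_, ?_, ?_, ?_, ?_⟩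
  · intro k hk hkp Δ δ hΔ hδ
    exact isEllipticalDisc_of_mem_iff hΔ hδ fun z =>
      mem_higherRankNumericalRange_scalarBlockMatrix_iff hs hs0 hk (by omega) (by omega)
  · intro k hk hkm
    ext z
    -- Singular values are indexed from `0`, so `p < k` gives `p ≤ k - 1` and the relevant one is
    -- zero: the ellipse collapses to a segment.
    rw [mem_higherRankNumericalRange_scalarBlockMatrix_iff hs hs0 (by omega) (by omega) (by omega),
      hzero _ (by omega), blockSupportSet_zero,
      ← mem_segment_translate ℝ ((α + β) / 2)]
    ring_nf
  · intro h k hk hkM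
    refine Set.Subset.antisymm (fun z hz => ?_) (Set.singleton_subset_iff.2 ?_)
    · exact eq_left_of_mem_higherRankNumericalRange (by omega) hz
    · exact left_mem_higherRankNumericalRange (by omega)
  · intro h k hk hkM
    refine Set.Subset.antisymm (fun z hz => ?_) (Set.singleton_subset_iff.2 ?_)
    · exact eq_right_of_mem_higherRankNumericalRange (by omega) hz
    · exact right_mem_higherRankNumericalRange (by omega)
  · intro h k hk hkn
    refine Set.eq_empty_of_forall_notMem fun z hz => h ?_
    exact (eq_left_of_mem_higherRankNumericalRange (by omega) hz).symm.trans
      (eq_right_of_mem_higherRankNumericalRange (by omega) hz)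
  · rintro rfl k hk hkn
    refine Set.Subset.antisymm (fun z hz => ?_) (Set.singleton_subset_iff.2 ?_)
    · exact eq_left_of_mem_higherRankNumericalRange (by omega) hz
    · exact mem_higherRankNumericalRange_scalarBlockMatrix_self hzero (by omega)
  · rintro rfl k hk hkn
    exact higherRankNumericalRange_scalarBlockMatrix_self_eq_empty hpos hzero hpr (by omega)
      (by omega)
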